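/- Let $\varphi_0(x)=1$, $\varphi_1(x)=x$ and, for $n=2^k+m$ with $k\ge 0$, $1\le m\le 2^k$, let $\varphi_n(x)=\max\{0,\,1-|2^{k+1}x-(2m-1)|\}$ be the Faber–Schauder functions on $[0,1]$. The Franklin system $(F_n)_{n\ge 0}$ is the sequence of continuous piecewise linear functions on $[0,1]$ obtained from $(\varphi_n)_{n\ge0}$ by Gram–Schmidt orthonormalization in $L^2(0,1)$. For a real- or complex-valued function $f\in L^1(0,1)$ put $$S_n(x,f)=\sum_{k=0}^{n}\Big(\int_0^1 f(t)F_k(t)\,dt\Big)F_k(x),\qquad x\in[0,1],$$ and let $(\theta_n)$ be a sequence of real numbers with $\theta_n=O(1/n)$. (a) Let $x\in[0,1]$ be a Lebesgue point of $f$, that is, $\lim_{h\to0+}\frac1{2h}\int_{[x-h,x+h]\cap[0,1]}|f(t)-f(x)|\,dt=0$, and suppose that $x+\theta_n\in[0,1]$ for all large $n$ (which is automatic if $0<x<1$). Then $S_n(x+\theta_n,f)\to f(x)$ as $n\to\infty$. (b) The same holds on the circle $\mathbb T=\mathbb R/\mathbb Z$: extend $f$ and $S_n(\cdot,f)$ from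 $[0,1)$ to $\mathbb R$ with period $1$. If $x\in\mathbb R$ is a Lebesgue point of the extended $f$, that is, $\lim_{h\to0+}\frac1{2h}\int_{x-h}^{x+h}|f(t)-f(x)|\,dt=0$, then $S_n(x+\theta_n,f)\to f(x)$ as $n\to\infty$. -/

import Mathlib

open Filter Topology MeasureTheory Asymptotics

/-- The Faber-Schauder system on `[0, 1]`: `φ₀ = 1`, `φ₁(x) = x`, and for `n = 2 ^ k + m` with
`1 ≤ m ≤ 2 ^ k` the tent function of height `1` with support `[(m - 1) / 2 ^ k, m / 2 ^ k]`
and peak at `(2 m - 1) / 2 ^ (k + 1)`. For `n ≥ 2` one has `k = Nat.log 2 (n - 1)`. -/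
noncomputable def faberSchauder (n : ℕ) (x : ℝ) : ℝ :=
  if n = 0 then 1
  else if n = 1 then x
  else max 0 (1 - |2 ^ (Nat.log 2 (n - 1) + 1) * x
    - (2 * ((n : ℝ) - 2 ^ Nat.log 2 (n - 1)) - 1)|)

/-- The Franklin system: the Gram-Schmidt orthonormalization in `L²(0, 1)` of the
Faber-Schauder system, as a sequence of (continuous, piecewise linear) functions.
Only the values on `[0, 1]` are meaningful. -/
noncomputable def franklin (n : ℕ) : ℝ → ℝ :=
  let g : ℝ → ℝ := fun x => faberSchauder n x -
    ∑ k : Fin n, (∫ t in (0 : ℝ)..1, faberSchauder n t * franklin k t) * franklin k x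
  fun x => g x / √(∫ t in (0 : ℝ)..1, g t ^ 2)
termination_by n
decreasing_by all_goals exact k.2

/-- The partial sum `S_n(x, f) = ∑_{k = 0}^n c_k F_k(x)`, `c_k = ∫₀¹ f F_k`, of the Fourier series
of `f` in the Franklin system `(F_k)`. -/
noncomputable def franklinSum {𝕜 : Type*} [RCLike 𝕜] (f : ℝ → 𝕜) (n : ℕ) (x : ℝ) : 𝕜 :=
  ∑ k ∈ Finset.range (n + 1), franklin k x • ∫ t in (0 : ℝ)..1, franklin k t • f t

/-- `x` is a Lebesgue point of `f`, regarded as a function on the set `s` of reals: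
`(1 / 2h) ∫_{s ∩ [x - h, x + h]} |f(t) - f(x)| dt → 0` as `h → 0+`. For an interval `s` this is the
usual notion at the interior points of `s` and the one-sided notion at the end points. -/
def IsLebesguePointOn {𝕜 : Type*} [RCLike 𝕜] (s : Set ℝ) (f : ℝ → 𝕜) (x : ℝ) : Prop :=
  Tendsto (fun h : ℝ => 1 / (2 * h) * ∫ t in s ∩ Set.Icc (x - h) (x + h), ‖f t - f x‖)
    (𝓝[>] 0) (𝓝 0)

/-! For `n = 2 ^ k + m` the span of the first `n + 1` Faber–Schauder functions is, on `[0, 1]`, the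
space of continuous functions affine between consecutive knots, whose gaps lie between `h / 2` and
`h = 2 ^ (-k)`. The partial sum `S_n f` is the `L²` projection onto it, so pairing with the hat
function at each knot gives a tridiagonal system for the knot values of `S_n f`, with right-hand
sides local integrals of `f`.

In each row the diagonal entry is twice the sum of the off-diagonal ones. Weighting the unknowns by
`exp (-|t_i - y| / (3h))` changes neighbours by a factor at most `exp (1/3) ≤ 3/2 < 2`, so diagonal
dominance survives. Looking at the row where the weighted value is largest (`exists_weighted_bound`)
bounds `S_n f(y)` by one local integral of `|f|` around a knot `t`, times `36 · 2 ^ k · exp (-2 ^ k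
|t - y| / 3)` (`norm_franklinSum_le`). No inverse matrix or kernel estimate is needed.

Constants are reproduced, so the bound applies to `f - a`. If `t` is near the Lebesgue point, the
local integral is small compared with the length of an interval about that point, and the
exponential absorbs the growth of that length with `|t - y|`. If `t` is far, the exponential beats
the factor `2 ^ k`. The shift `θ_n = O(1/n)` merely enlarges the interval by a multiple of the mesh
size. -/

/-! ### Piecewise affine functions and hat functions -/

/-- `u` coincides with an affine function on `[a, b]`. -/
def AffineOnIcc (u : ℝ → ℝ) (a b : ℝ) : Prop :=
  ∃ α β : ℝ, ∀ s ∈ Set.Icc a b, u s = α * s + β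

theorem AffineOnIcc.mono {u : ℝ → ℝ} {a b c d : ℝ} (h : AffineOnIcc u a b)
    (hs : Set.Icc c d ⊆ Set.Icc a b) : AffineOnIcc u c d := by
  obtain ⟨α, β, h⟩ := h
  exact ⟨α, β, fun s hs' => h s (hs hs')⟩

theorem AffineOnIcc.add {u v : ℝ → ℝ} {a b : ℝ} (hu : AffineOnIcc u a b)
    (hv : AffineOnIcc v a b) : AffineOnIcc (u + v) a b := by
  obtain ⟨α, β, hu⟩ := hu
  obtain ⟨γ, δ, hv⟩ := hv
  exact ⟨α + γ, β + δ, fun s hs => by rw [Pi.add_apply, hu s hs, hv s hs]; ring⟩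

theorem AffineOnIcc.smul {u : ℝ → ℝ} {a b : ℝ} (c : ℝ) (hu : AffineOnIcc u a b) :
    AffineOnIcc (c • u) a b := by
  obtain ⟨α, β, hu⟩ := hu
  exact ⟨c * α, c * β, fun s hs => by rw [Pi.smul_apply, hu s hs, smul_eq_mul]; ring⟩

theorem AffineOnIcc.eq_interpolation {u : ℝ → ℝ} {a b : ℝ} (hu : AffineOnIcc u a b) (hab : a < b)
    {s : ℝ} (hs : s ∈ Set.Icc a b) :
    u s = (b - s) / (b - a) * u a + (s - a) / (b - a) * u b := by
  obtain ⟨α, β, hu⟩ := hu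
  rw [hu s hs, hu a (Set.left_mem_Icc.2 hab.le), hu b (Set.right_mem_Icc.2 hab.le)]
  have : b - a ≠ 0 := (sub_pos.2 hab).ne'
  field_simp
  ring

theorem integral_mul_of_affineOnIcc {u w : ℝ → ℝ} {a b : ℝ} (hab : a ≤ b)
    (hu : AffineOnIcc u a b) (hw : AffineOnIcc w a b) :
    ∫ s in a..b, u s * w s =
      (b - a) / 6 * (2 * u a * w a + u a * w b + u b * w a + 2 * u b * w b) := by
  obtain ⟨α, β, hu⟩ := hu
  obtain ⟨γ, δ, hw⟩ := hw
  rw [intervalIntegral.integral_congr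
    (g := fun s => α * γ * s ^ 2 + (α * δ + β * γ) * s + β * δ)]
  · rw [intervalIntegral.integral_add (Continuous.intervalIntegrable (by fun_prop) _ _)
        (Continuous.intervalIntegrable (by fun_prop) _ _),
      intervalIntegral.integral_add (Continuous.intervalIntegrable (by fun_prop) _ _)
        (Continuous.intervalIntegrable (by fun_prop) _ _),
      intervalIntegral.integral_const_mul, intervalIntegral.integral_const_mul, integral_pow,
      integral_id, intervalIntegral.integral_const,
      hu a (Set.left_mem_Icc.2 hab), hu b (Set.right_mem_Icc.2 hab),
      hw a (Set.left_mem_Icc.2 hab), hw b (Set.right_mem_Icc.2 hab)]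
    simp only [smul_eq_mul]
    norm_num
    ring
  · intro s hs
    rw [Set.uIcc_of_le hab] at hs
    simp only [hu s hs, hw s hs]
    ring

theorem exists_mem_Icc_succ (t : ℕ → ℝ) {N : ℕ} (hN : N ≠ 0) {y : ℝ} (h0 : t 0 ≤ y)
    (h1 : y ≤ t N) : ∃ i < N, y ∈ Set.Icc (t i) (t (i + 1)) := by
  induction N with
  | zero => exact absurd rfl hN
  | succ N ih =>
    rcases le_total y (t N) with h | h
    · rcases Nat.eq_zero_or_pos N with rfl | hpos
      · exact ⟨0, by omega, h0, h1⟩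
      · obtain ⟨i, hi, hy⟩ := ih hpos.ne' h
        exact ⟨i, by omega, hy⟩
    · exact ⟨N, by omega, h, h1⟩

/-- Pairing a piecewise linear function with the hat function at the knot `t j`. -/
theorem integral_mul_hat {t : ℕ → ℝ} (ht : Monotone t) {N j : ℕ} (hj : j ≤ N) {u w : ℝ → ℝ}
    (huc : Continuous u) (hwc : Continuous w)
    (hu : ∀ i < N, AffineOnIcc u (t i) (t (i + 1)))
    (hw : ∀ i < N, AffineOnIcc w (t i) (t (i + 1)))
    (hwj : ∀ i ≤ N, w (t i) = if i = j then 1 else 0) :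
    ∫ s in t 0..t N, u s * w s =
      (if j < N then (t (j + 1) - t j) / 6 * (2 * u (t j) + u (t (j + 1))) else 0) +
      (if 0 < j then (t j - t (j - 1)) / 6 * (u (t (j - 1)) + 2 * u (t j)) else 0) := by
  rw [← intervalIntegral.sum_integral_adjacent_intervals (f := fun s => u s * w s) (a := t)
    (n := N) fun i _ => (huc.mul hwc).intervalIntegrable _ _]
  have key : ∀ i ∈ Finset.range N, ∫ s in t i..t (i + 1), u s * w s =
      (if j = i then (t (i + 1) - t i) / 6 * (2 * u (t i) + u (t (i + 1))) else 0) +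
      (if j = i + 1 then (t (i + 1) - t i) / 6 * (u (t i) + 2 * u (t (i + 1))) else 0) := by
    intro i hi
    have hi := Finset.mem_range.1 hi
    rw [integral_mul_of_affineOnIcc (ht (Nat.le_succ i)) (hu i hi) (hw i hi),
      hwj i hi.le, hwj (i + 1) hi]
    rcases eq_or_ne i j with rfl | h1
    · simp
    · rcases eq_or_ne (i + 1) j with rfl | h2
      · simp
      · simp [h1, h2, h1.symm, h2.symm]
  rw [Finset.sum_congr rfl key, Finset.sum_add_distrib, Finset.sum_ite_eq]
  congr 1
  · simp
  · rcases Nat.eq_zero_or_pos j with rfl | hpos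
    · simp
    · obtain ⟨i, rfl⟩ := Nat.exists_eq_succ_of_ne_zero hpos.ne'
      simp only [Nat.succ_eq_add_one, add_left_inj, Finset.sum_ite_eq, Finset.mem_range,
        Nat.add_sub_cancel, Nat.succ_pos, if_true]
      rw [if_pos (by omega)]

/-- On each gap `w` is a convex combination of its end values, which are `0` or `1`; it is nonzero
only on the at most two gaps adjacent to `t j`, each of length at most `h`. -/
theorem abs_hat_le {t : ℕ → ℝ} {h : ℝ} (ht : StrictMono t)
    (hh : ∀ i, t (i + 1) - t i ≤ h) {N j : ℕ} (hN : N ≠ 0) {w : ℝ → ℝ}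
    (hw : ∀ i < N, AffineOnIcc w (t i) (t (i + 1)))
    (hwj : ∀ i ≤ N, w (t i) = if i = j then 1 else 0) {s : ℝ} (hs : s ∈ Set.Icc (t 0) (t N)) :
    |w s| ≤ (Set.Icc (t j - h) (t j + h)).indicator 1 s := by
  obtain ⟨i, hi, hsi⟩ := exists_mem_Icc_succ t hN hs.1 hs.2
  have hlt : t i < t (i + 1) := ht (Nat.lt_succ_self i)
  rw [(hw i hi).eq_interpolation hlt hsi, hwj i hi.le, hwj (i + 1) hi]
  have hpos := sub_pos.2 hlt
  have e1 : 0 ≤ (t (i + 1) - s) / (t (i + 1) - t i) :=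
    div_nonneg (sub_nonneg.2 hsi.2) hpos.le
  have e2 : 0 ≤ (s - t i) / (t (i + 1) - t i) := div_nonneg (sub_nonneg.2 hsi.1) hpos.le
  have e3 : (t (i + 1) - s) / (t (i + 1) - t i) + (s - t i) / (t (i + 1) - t i) = 1 := by
    field_simp
    ring
  have h0 : ∀ i, t i < t (i + 1) := fun i => ht (Nat.lt_succ_self i)
  by_cases hmem : s ∈ Set.Icc (t j - h) (t j + h)
  · rw [Set.indicator_of_mem hmem, Pi.one_apply, abs_of_nonneg (by split_ifs <;> linarith)]
    split_ifs <;> linarith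
  · have h1 : i ≠ j := by
      rintro rfl
      exact hmem ⟨by linarith [hsi.1, hh i], by linarith [hsi.2, hh i]⟩
    have h2 : i + 1 ≠ j := by
      rintro rfl
      exact hmem ⟨by linarith [hsi.1, hh i], by linarith [hsi.2, hh i]⟩
    rw [Set.indicator_of_notMem hmem]
    simp [h1, h2]

/-! ### Weighted diagonal dominance -/

theorem exp_one_third_le : Real.exp (1 / 3) ≤ 3 / 2 := by
  have h1 : Real.exp (1 / 3) ^ 3 = Real.exp 1 := by
    rw [← Real.exp_nat_mul]; norm_num
  have h2 := Real.exp_one_lt_d9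
  by_contra! h
  have : (3 / 2 : ℝ) ^ 3 < Real.exp (1 / 3) ^ 3 := by gcongr
  rw [h1] at this
  norm_num at this
  linarith

/-- A weighted maximum principle for the Gram matrix of the hat functions. -/
theorem exists_weighted_bound {E : Type*} [NormedAddCommGroup E] [NormedSpace ℝ E]
    {t : ℕ → ℝ} {h : ℝ} (hpos : 0 < h) (hl : ∀ i, h / 2 ≤ t (i + 1) - t i)
    (hh : ∀ i, t (i + 1) - t i ≤ h) {N : ℕ} (hN : N ≠ 0) (U b : ℕ → E)
    (hb : ∀ j ≤ N,
      (if j < N then ((t (j + 1) - t j) / 6) • ((2 : ℝ) • U j + U (j + 1)) else 0) +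
      (if 0 < j then ((t j - t (j - 1)) / 6) • (U (j - 1) + (2 : ℝ) • U j) else 0) = b j)
    (y : ℝ) :
    ∃ j ≤ N, ∀ i ≤ N, Real.exp (-(|t i - y| / (3 * h))) * ‖U i‖ ≤
      24 / h * Real.exp (-(|t j - y| / (3 * h))) * ‖b j‖ := by
  obtain ⟨j, hj, hmax⟩ := (Finset.range (N + 1)).exists_max_image
    (fun i => Real.exp (-(|t i - y| / (3 * h))) * ‖U i‖) ⟨0, by simp⟩
  simp only [Finset.mem_range, Nat.lt_succ_iff] at hj hmax
  refine ⟨j, hj, fun i hi => (hmax i hi).trans ?_⟩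
  -- By maximality at `j`, a knot within `h` has unweighted norm larger by at most the ratio of the
  -- weights, which is at most `exp (1/3)`.
  have hnb : ∀ i ≤ N, |t i - t j| ≤ h → ‖U i‖ ≤ 3 / 2 * ‖U j‖ := by
    intro i hi hd
    have h1 := hmax i hi
    have h2 : Real.exp (-(|t j - y| / (3 * h))) ≤
        3 / 2 * Real.exp (-(|t i - y| / (3 * h))) := by
      refine le_trans ?_ (mul_le_mul_of_nonneg_right exp_one_third_le (Real.exp_pos _).le)
      rw [← Real.exp_add, Real.exp_le_exp]
      have h3 : |t i - y| ≤ h + |t j - y| := by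
        have := abs_add_le (t i - t j) (t j - y)
        rw [sub_add_sub_cancel] at this
        linarith
      have h4 : |t i - y| / (3 * h) ≤ (h + |t j - y|) / (3 * h) := by gcongr
      have h5 : (h + |t j - y|) / (3 * h) = 1 / 3 + |t j - y| / (3 * h) := by field_simp
      linarith
    have h3 : Real.exp (-(|t i - y| / (3 * h))) * ‖U i‖ ≤
        Real.exp (-(|t i - y| / (3 * h))) * (3 / 2 * ‖U j‖) := by
      refine h1.trans ((mul_le_mul_of_nonneg_right h2 (norm_nonneg _)).trans_eq ?_)
      ring
    exact le_of_mul_le_mul_left h3 (Real.exp_pos _)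
  -- With `c` the total length of the gaps adjacent to `t j`, the diagonal term is `c / 3` and the
  -- off-diagonal ones cost at most `(c / 6) · (3 / 2) = c / 4`. What remains is `c / 12 ≥ h / 24`.
  have hmain : h / 24 * ‖U j‖ ≤ ‖b j‖ := by
    have two : ∀ (c : ℝ) (V : E), h / 2 ≤ c → ‖V‖ ≤ 3 / 2 * ‖U j‖ →
        ‖(c / 6) • V‖ ≤ c / 4 * ‖U j‖ := by
      intro c V hc hV
      rw [norm_smul, Real.norm_of_nonneg (by linarith)]
      have : c / 6 * ‖V‖ ≤ c / 6 * (3 / 2 * ‖U j‖) := by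
        apply mul_le_mul_of_nonneg_left hV; linarith
      linarith
    have hnn := norm_nonneg (U j)
    have fin : ∀ (c : ℝ) (V : E), h / 2 ≤ c → ‖V‖ ≤ c / 4 * ‖U j‖ →
        h / 24 * ‖U j‖ ≤ ‖(c / 3) • U j + V‖ := by
      intro c V hc hV
      have h1 := norm_sub_le ((c / 3) • U j + V) V
      rw [add_sub_cancel_right, norm_smul, Real.norm_of_nonneg (by linarith)] at h1
      nlinarith
    have hbj := hb j hj
    have right : j < N → ‖((t (j + 1) - t j) / 6) • U (j + 1)‖ ≤
        (t (j + 1) - t j) / 4 * ‖U j‖ := fun h1 => two _ _ (hl j) (hnb _ h1 (by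
      rw [abs_of_nonneg (by linarith [hl j])]; exact hh j))
    have left : 0 < j → h / 2 ≤ t j - t (j - 1) ∧ ‖((t j - t (j - 1)) / 6) • U (j - 1)‖ ≤
        (t j - t (j - 1)) / 4 * ‖U j‖ := by
      intro h1
      have e : j - 1 + 1 = j := by omega
      have h2 := hl (j - 1)
      have h3 := hh (j - 1)
      rw [e] at h2 h3
      refine ⟨h2, two _ _ h2 (hnb _ (by omega) ?_)⟩
      rw [abs_sub_comm, abs_of_nonneg (by linarith)]
      exact h3
    by_cases h1 : j < N
    · by_cases h2 : 0 < j
      · rw [if_pos h1, if_pos h2] at hbj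
        have := fin (t (j + 1) - t j + (t j - t (j - 1)))
          (((t (j + 1) - t j) / 6) • U (j + 1) + ((t j - t (j - 1)) / 6) • U (j - 1))
          (by linarith [hl j, (left h2).1])
          ((norm_add_le _ _).trans (by linarith [right h1, (left h2).2]))
        refine this.trans_eq ?_
        rw [← hbj]
        congr 1
        module
      · rw [if_pos h1, if_neg h2] at hbj
        refine (fin _ _ (hl j) (right h1)).trans_eq ?_
        rw [← hbj]
        congr 1
        module
    · have h2 : 0 < j := by omega
      rw [if_neg h1, if_pos h2] at hbj
      refine (fin _ _ (left h2).1 (left h2).2).trans_eq ?_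
      rw [← hbj]
      congr 1
      module
  have : ‖U j‖ ≤ 24 / h * ‖b j‖ := by
    rw [div_mul_eq_mul_div, le_div_iff₀ hpos]
    linarith
  calc _ ≤ Real.exp (-(|t j - y| / (3 * h))) * (24 / h * ‖b j‖) := by gcongr
    _ = _ := by ring

/-! ### Orthogonality and the projection property -/

/-- The component of `faberSchauder n` orthogonal to the preceding Franklin functions. -/
noncomputable def franklinResidual (n : ℕ) (x : ℝ) : ℝ :=
  faberSchauder n x -
    ∑ k ∈ Finset.range n, (∫ t in (0 : ℝ)..1, faberSchauder n t * franklin k t) * franklin k x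

theorem franklin_eq (n : ℕ) (x : ℝ) :
    franklin n x = franklinResidual n x / √(∫ t in (0 : ℝ)..1, franklinResidual n t ^ 2) := by
  have h : ∀ y, franklinResidual n y = faberSchauder n y -
      ∑ k : Fin n, (∫ t in (0 : ℝ)..1, faberSchauder n t * franklin k t) * franklin k y := by
    intro y
    rw [franklinResidual, Finset.sum_range]
  rw [franklin]
  simp only [h]

theorem continuous_faberSchauder (n : ℕ) : Continuous (faberSchauder n) := by
  unfold faberSchauder
  split_ifs <;> fun_prop

theorem continuous_franklin (n : ℕ) : Continuous (franklin n) := by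
  induction n using Nat.strong_induction_on with
  | _ n ih =>
    have h : Continuous (franklinResidual n) := by
      unfold franklinResidual
      refine (continuous_faberSchauder n).sub (continuous_finsetSum _ fun k hk => ?_)
      exact continuous_const.mul (ih k (Finset.mem_range.1 hk))
    rw [show franklin n = _ from funext (franklin_eq n)]
    exact h.div_const _

theorem continuous_franklinResidual (n : ℕ) : Continuous (franklinResidual n) := by
  unfold franklinResidual
  exact (continuous_faberSchauder n).sub
    (continuous_finsetSum _ fun k _ => continuous_const.mul (continuous_franklin k))

theorem integral_franklinResidual_sq_nonneg (n : ℕ) :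
    0 ≤ ∫ t in (0 : ℝ)..1, franklinResidual n t ^ 2 :=
  intervalIntegral.integral_nonneg zero_le_one fun _ _ => sq_nonneg _

/-- Division by zero yields `0`, so a vanishing residual would give `franklin n = 0`. Orthogonality
and projection hold in both alternatives, so linear independence of the Faber–Schauder system is
never needed. -/
theorem franklin_eq_zero_or_integral_sq (n : ℕ) :
    franklin n = 0 ∨ ∫ t in (0 : ℝ)..1, franklin n t * franklin n t = 1 := by
  by_cases h : ∫ t in (0 : ℝ)..1, franklinResidual n t ^ 2 = 0
  · left
    funext x
    simp [franklin_eq, h]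
  · right
    have h2 : ∀ t, franklin n t * franklin n t =
        franklinResidual n t ^ 2 / ∫ t in (0 : ℝ)..1, franklinResidual n t ^ 2 := by
      intro t
      rw [franklin_eq, div_mul_div_comm,
        Real.mul_self_sqrt (integral_franklinResidual_sq_nonneg n), sq]
    simp only [h2]
    rw [intervalIntegral.integral_div, div_self h]

/-- If the residual has norm zero, continuity forces it to vanish on `[0, 1]`, but not outside;
hence the restriction on `x`. -/
theorem franklinResidual_eq (n : ℕ) {x : ℝ} (hx : x ∈ Set.Icc (0 : ℝ) 1) :
    franklinResidual n x = √(∫ t in (0 : ℝ)..1, franklinResidual n t ^ 2) * franklin n x := by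
  by_cases h : ∫ t in (0 : ℝ)..1, franklinResidual n t ^ 2 = 0
  · rw [h, Real.sqrt_zero, zero_mul]
    by_contra hne
    have : 0 < ∫ t in (0 : ℝ)..1, franklinResidual n t ^ 2 :=
      intervalIntegral.integral_pos zero_lt_one
        ((continuous_franklinResidual n).pow 2).continuousOn (fun _ _ => sq_nonneg _)
        ⟨x, hx, by positivity⟩
    exact this.ne' h
  · rw [franklin_eq, mul_div_cancel₀]
    exact (Real.sqrt_pos.2 ((integral_franklinResidual_sq_nonneg n).lt_of_ne' h)).ne'

theorem integral_franklin_mul_of_lt {n j : ℕ} (hj : j < n) :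
    ∫ t in (0 : ℝ)..1, franklin n t * franklin j t = 0 := by
  induction n using Nat.strong_induction_on generalizing j with
  | _ n ih =>
    have key : ∫ t in (0 : ℝ)..1, franklinResidual n t * franklin j t = 0 := by
      have hI : ∀ k, IntervalIntegrable (fun t => franklin k t * franklin j t) volume 0 1 :=
        fun k => ((continuous_franklin k).mul (continuous_franklin j)).intervalIntegrable _ _
      simp only [franklinResidual, sub_mul, Finset.sum_mul]
      rw [intervalIntegral.integral_sub, intervalIntegral.integral_finsetSum,
        Finset.sum_eq_single_of_mem j (Finset.mem_range.2 hj)]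
      · simp only [mul_assoc, intervalIntegral.integral_const_mul]
        rcases franklin_eq_zero_or_integral_sq j with h | h
        · simp [h]
        · rw [h]; ring
      · intro k hk hkj
        simp only [mul_assoc, intervalIntegral.integral_const_mul]
        rcases lt_or_gt_of_ne hkj with h | h
        · simp_rw [mul_comm (franklin k _)]
          rw [ih j hj h, mul_zero]
        · rw [ih k (Finset.mem_range.1 hk) h, mul_zero]
      · intro k _
        simpa only [mul_assoc] using (hI k).const_mul _
      · exact ((continuous_faberSchauder n).mul (continuous_franklin j)).intervalIntegrable _ _
      · refine Continuous.intervalIntegrable (continuous_finsetSum _ fun k _ => ?_) _ _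
        exact (continuous_const.mul (continuous_franklin k)).mul (continuous_franklin j)
    have h2 : ∀ t, franklin n t * franklin j t = franklinResidual n t * franklin j t /
        √(∫ t in (0 : ℝ)..1, franklinResidual n t ^ 2) := by
      intro t
      rw [franklin_eq n]; ring
    simp only [h2]
    rw [intervalIntegral.integral_div, key, zero_div]

theorem integral_franklin_mul_of_ne {n j : ℕ} (hj : n ≠ j) :
    ∫ t in (0 : ℝ)..1, franklin n t * franklin j t = 0 := by
  rcases lt_or_gt_of_ne hj with h | h
  · simp_rw [mul_comm (franklin n _)]
    exact integral_franklin_mul_of_lt h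
  · exact integral_franklin_mul_of_lt h

theorem franklin_zero (x : ℝ) : franklin 0 x = 1 := by
  rw [franklin_eq]
  simp [franklinResidual, faberSchauder]

theorem intervalIntegrable_continuous_smul {𝕜 : Type*} [RCLike 𝕜]
    {f : ℝ → 𝕜} (hf : IntervalIntegrable f volume 0 1)
    {w : ℝ → ℝ} (hw : Continuous w) : IntervalIntegrable (fun t => w t • f t) volume 0 1 :=
  hf.continuousOn_smul hw.continuousOn

/-- `franklinSum f n` is the `L²`-projection: it pairs with `w` as `f` does. -/
def FranklinReproduces {𝕜 : Type*} [RCLike 𝕜] (f : ℝ → 𝕜) (n : ℕ) (w : ℝ → ℝ) : Prop :=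
  ∑ k ∈ Finset.range (n + 1), (∫ t in (0 : ℝ)..1, franklin k t * w t) •
    (∫ t in (0 : ℝ)..1, franklin k t • f t) = ∫ t in (0 : ℝ)..1, w t • f t

theorem FranklinReproduces.add {𝕜 : Type*} [RCLike 𝕜]
    {f : ℝ → 𝕜} (hf : IntervalIntegrable f volume 0 1) {n : ℕ}
    {v w : ℝ → ℝ} (hv : Continuous v) (hw : Continuous w) (h1 : FranklinReproduces f n v)
    (h2 : FranklinReproduces f n w) : FranklinReproduces f n (v + w) := by
  unfold FranklinReproduces at *
  simp only [Pi.add_apply, mul_add, add_smul]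
  rw [intervalIntegral.integral_add (intervalIntegrable_continuous_smul hf hv)
    (intervalIntegrable_continuous_smul hf hw), ← h1, ← h2, ← Finset.sum_add_distrib]
  refine Finset.sum_congr rfl fun k _ => ?_
  rw [intervalIntegral.integral_add, add_smul]
  · exact ((continuous_franklin k).mul hv).intervalIntegrable _ _
  · exact ((continuous_franklin k).mul hw).intervalIntegrable _ _

theorem FranklinReproduces.smul {𝕜 : Type*} [RCLike 𝕜] {f : ℝ → 𝕜} {n : ℕ} {w : ℝ → ℝ} (a : ℝ)
    (h : FranklinReproduces f n w) : FranklinReproduces f n (a • w) := by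
  unfold FranklinReproduces at *
  simp only [Pi.smul_apply, smul_eq_mul, mul_smul, intervalIntegral.integral_smul, ← h,
    Finset.smul_sum]
  refine Finset.sum_congr rfl fun k _ => ?_
  rw [← mul_smul, ← intervalIntegral.integral_const_mul]
  simp only [mul_left_comm]

theorem FranklinReproduces.zero {𝕜 : Type*} [RCLike 𝕜]
    (f : ℝ → 𝕜) (n : ℕ) : FranklinReproduces f n 0 := by
  simp [FranklinReproduces]

theorem FranklinReproduces.congr {𝕜 : Type*} [RCLike 𝕜] {f : ℝ → 𝕜} {n : ℕ} {v w : ℝ → ℝ}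
    (h : FranklinReproduces f n v) (hvw : ∀ x ∈ Set.Icc (0 : ℝ) 1, w x = v x) :
    FranklinReproduces f n w := by
  unfold FranklinReproduces at *
  rw [← Set.uIcc_of_le zero_le_one] at hvw
  rw [intervalIntegral.integral_congr (g := fun t => v t • f t) fun t ht => by
    simp only [hvw t ht], ← h]
  refine Finset.sum_congr rfl fun k _ => ?_
  rw [intervalIntegral.integral_congr (g := fun t => franklin k t * v t) fun t ht => by
    simp only [hvw t ht]]

theorem franklinReproduces_franklin {𝕜 : Type*} [RCLike 𝕜] (f : ℝ → 𝕜) {n j : ℕ} (hj : j ≤ n) :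
    FranklinReproduces f n (franklin j) := by
  unfold FranklinReproduces
  rw [Finset.sum_eq_single_of_mem j (Finset.mem_range.2 (by omega))]
  · rcases franklin_eq_zero_or_integral_sq j with h | h
    · simp [h]
    · rw [h, one_smul]
  · intro k _ hk
    rw [integral_franklin_mul_of_ne hk, zero_smul]

/-- Undoing Gram–Schmidt writes `faberSchauder j`, on `[0, 1]`, as a combination of Franklin
functions of index at most `j`, the last coefficient being the norm of the residual. -/
theorem franklinReproduces_faberSchauder {𝕜 : Type*} [RCLike 𝕜]
    {f : ℝ → 𝕜} (hf : IntervalIntegrable f volume 0 1)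
    {n j : ℕ} (hj : j ≤ n) : FranklinReproduces f n (faberSchauder j) := by
  have hsum : ∀ (c : ℕ → ℝ) (s : Finset ℕ), (∀ k ∈ s, k ≤ n) →
      FranklinReproduces f n (∑ k ∈ s, c k • franklin k) := by
    intro c s
    induction s using Finset.induction_on with
    | empty => intro _; simpa using FranklinReproduces.zero f n
    | insert a s ha ih =>
      intro hs
      rw [Finset.sum_insert ha]
      refine FranklinReproduces.add hf ((continuous_franklin a).const_smul (c a)) ?_
        ((franklinReproduces_franklin f (hs a (Finset.mem_insert_self a s))).smul _)
        (ih fun k hk => hs k (Finset.mem_insert_of_mem hk))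
      have : Continuous fun x => ∑ k ∈ s, c k • franklin k x :=
        continuous_finsetSum _ fun k _ => (continuous_franklin k).const_smul (c k)
      convert this using 1
      ext x; simp
  let c : ℕ → ℝ := fun k => if k < j then ∫ t in (0 : ℝ)..1, faberSchauder j t * franklin k t
    else √(∫ t in (0 : ℝ)..1, franklinResidual j t ^ 2)
  refine (hsum c (Finset.range (j + 1)) fun k hk => by
    have := Finset.mem_range.1 hk; omega).congr fun x hx => ?_
  rw [Finset.sum_apply, Finset.sum_range_succ]
  have h1 := franklinResidual_eq j hx
  have h2 : ∑ k ∈ Finset.range j, (c k • franklin k) x = ∑ k ∈ Finset.range j,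
      (∫ t in (0 : ℝ)..1, faberSchauder j t * franklin k t) * franklin k x :=
    Finset.sum_congr rfl fun k hk => by simp [c, Finset.mem_range.1 hk]
  rw [h2]
  simp only [c, lt_irrefl, if_false, Pi.smul_apply, smul_eq_mul]
  rw [← h1, franklinResidual]
  ring

theorem continuous_of_mem_span_faberSchauder {n : ℕ} {w : ℝ → ℝ}
    (hw : w ∈ Submodule.span ℝ (faberSchauder '' Set.Iic n)) : Continuous w := by
  induction hw using Submodule.span_induction with
  | mem x h => obtain ⟨j, -, rfl⟩ := h; exact continuous_faberSchauder j
  | zero => exact continuous_zero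
  | add x y _ _ hx hy => exact hx.add hy
  | smul a x _ hx => exact hx.const_smul a

theorem franklinReproduces_of_mem_span {𝕜 : Type*} [RCLike 𝕜]
    {f : ℝ → 𝕜} (hf : IntervalIntegrable f volume 0 1)
    {n : ℕ} {w : ℝ → ℝ} (hw : w ∈ Submodule.span ℝ (faberSchauder '' Set.Iic n)) :
    FranklinReproduces f n w := by
  induction hw using Submodule.span_induction with
  | mem x h => obtain ⟨j, hj, rfl⟩ := h; exact franklinReproduces_faberSchauder hf hj
  | zero => exact FranklinReproduces.zero f n
  | add x y h1 h2 hx hy =>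
    exact hx.add hf (continuous_of_mem_span_faberSchauder h1)
      (continuous_of_mem_span_faberSchauder h2) hy
  | smul a x _ hx => exact hx.smul a

theorem franklin_mem_span (n : ℕ) :
    franklin n ∈ Submodule.span ℝ (faberSchauder '' Set.Iic n) := by
  induction n using Nat.strong_induction_on with
  | _ n ih =>
    have h : franklin n = (√(∫ t in (0 : ℝ)..1, franklinResidual n t ^ 2))⁻¹ •
        (faberSchauder n - ∑ k ∈ Finset.range n,
          (∫ t in (0 : ℝ)..1, faberSchauder n t * franklin k t) • franklin k) := by
      funext x
      rw [franklin_eq n x]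
      simp [franklinResidual, div_eq_inv_mul]
    rw [h]
    refine Submodule.smul_mem _ _ (Submodule.sub_mem _
      (Submodule.subset_span ⟨n, Set.mem_Iic.2 le_rfl, rfl⟩)
      (Submodule.sum_mem _ fun k hk => Submodule.smul_mem _ _ ?_))
    have hk := Finset.mem_range.1 hk
    exact Submodule.span_mono (Set.image_mono (Set.Iic_subset_Iic.2 hk.le)) (ih k hk)

/-- A constant is a multiple of `franklin 0 = 1`, and the other Franklin functions are orthogonal to
it. -/
theorem franklinSum_sub_const {𝕜 : Type*} [RCLike 𝕜]
    {f : ℝ → 𝕜} (hf : IntervalIntegrable f volume 0 1) (a : 𝕜)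
    (n : ℕ) (x : ℝ) : franklinSum (fun t => f t - a) n x = franklinSum f n x - a := by
  have h : ∑ k ∈ Finset.range (n + 1), franklin k x •
      ∫ t in (0 : ℝ)..1, franklin k t • a = a := by
    rw [Finset.sum_eq_single_of_mem 0 (Finset.mem_range.2 (by omega))]
    · simp [franklin_zero]
    · intro k _ hk
      have := integral_franklin_mul_of_ne hk
      simp only [franklin_zero, mul_one] at this
      rw [intervalIntegral.integral_smul_const, this, zero_smul, smul_zero]
  rw [franklinSum, franklinSum]
  nth_rw 2 [← h]
  rw [← Finset.sum_sub_distrib]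
  refine Finset.sum_congr rfl fun k _ => ?_
  rw [← smul_sub, ← intervalIntegral.integral_sub
    (intervalIntegrable_continuous_smul hf (continuous_franklin k))
    (intervalIntegrable_continuous_smul intervalIntegrable_const (continuous_franklin k))]
  simp only [smul_sub]

/-! ### Dyadic knots and the spline space -/

/-- The knots of the span of the first `2 ^ k + m + 1` Faber-Schauder functions, `m ≤ 2 ^ k`, in
increasing order: spacing `2⁻¹ ^ (k + 1)` up to the index `2 m`, then spacing `2⁻¹ ^ k`. -/
noncomputable def franklinKnot (k m i : ℕ) : ℝ :=
  max (i : ℝ) (2 * i - 2 * m) / 2 ^ (k + 1)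

theorem franklinKnot_of_le {k m i : ℕ} (h : i ≤ 2 * m) :
    franklinKnot k m i = i / 2 ^ (k + 1) := by
  have : (i : ℝ) ≤ 2 * m := by exact_mod_cast h
  rw [franklinKnot, max_eq_left (by linarith)]

theorem franklinKnot_of_ge {k m i : ℕ} (h : 2 * m ≤ i) :
    franklinKnot k m i = (2 * i - 2 * m) / 2 ^ (k + 1) := by
  have : 2 * (m : ℝ) ≤ i := by exact_mod_cast h
  rw [franklinKnot, max_eq_right (by linarith)]

theorem franklinKnot_zero (k m : ℕ) : franklinKnot k m 0 = 0 := by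
  simp [franklinKnot]

theorem franklinKnot_last {k m : ℕ} (hm : m ≤ 2 ^ k) : franklinKnot k m (2 ^ k + m) = 1 := by
  rw [franklinKnot_of_ge (by omega)]
  push_cast
  rw [pow_succ]
  field_simp
  ring

/-- The knot formula continues past `1`, so the gap bounds hold for every index. -/
theorem franklinKnot_succ_sub (k m i : ℕ) :
    (1 / 2 ^ k : ℝ) / 2 ≤ franklinKnot k m (i + 1) - franklinKnot k m i ∧
      franklinKnot k m (i + 1) - franklinKnot k m i ≤ 1 / 2 ^ k := by
  have h2 : (0 : ℝ) < 2 ^ k := by positivity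
  rcases Nat.lt_or_ge i (2 * m) with h | h
  · rw [franklinKnot_of_le h, franklinKnot_of_le h.le, pow_succ, ← sub_div]
    push_cast
    rw [add_sub_cancel_left, div_div]
    refine ⟨le_rfl, ?_⟩
    gcongr
    linarith
  · rw [franklinKnot_of_ge h, franklinKnot_of_ge (by omega), pow_succ, ← sub_div]
    push_cast
    have : ((2 : ℝ) * (i + 1) - 2 * m - (2 * i - 2 * m)) / (2 ^ k * 2) = 1 / 2 ^ k := by
      field_simp
      ring
    rw [this]
    refine ⟨?_, le_rfl⟩
    have : (0 : ℝ) < 1 / 2 ^ k := by positivity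
    linarith

theorem strictMono_franklinKnot (k m : ℕ) : StrictMono (franklinKnot k m) := by
  refine strictMono_nat_of_lt_succ fun i => ?_
  have := (franklinKnot_succ_sub k m i).1
  have : (0 : ℝ) < 1 / 2 ^ k := by positivity
  linarith

theorem franklinKnot_next_level {k i : ℕ} (hi : i ≤ 2 ^ k + 2 ^ k) :
    franklinKnot (k + 1) 0 i = franklinKnot k (2 ^ k) i := by
  rw [franklinKnot_of_ge (Nat.zero_le _), franklinKnot_of_le (by omega), pow_succ 2 (k + 1)]
  push_cast
  field_simp
  ring

theorem franklinKnot_succ_of_le {k m i : ℕ} (hi : i ≤ 2 * m) :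
    franklinKnot k (m + 1) i = franklinKnot k m i := by
  rw [franklinKnot_of_le hi, franklinKnot_of_le (by omega)]

theorem franklinKnot_succ_mid {k m : ℕ} :
    franklinKnot k (m + 1) (2 * m + 1) = (2 * m + 1) / 2 ^ (k + 1) := by
  rw [franklinKnot_of_le (by omega)]
  push_cast
  rfl

theorem franklinKnot_succ_of_ge {k m i : ℕ} (hi : 2 * m + 1 ≤ i) :
    franklinKnot k (m + 1) (i + 1) = franklinKnot k m i := by
  rw [franklinKnot_of_ge (by omega), franklinKnot_of_ge (by omega)]
  push_cast
  ring_nf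

theorem faberSchauder_of_lt {k m : ℕ} (hm : m < 2 ^ k) (x : ℝ) :
    faberSchauder (2 ^ k + m + 1) x = max 0 (1 - |2 ^ (k + 1) * x - (2 * m + 1)|) := by
  -- Here `m` counts from zero: the index is `2 ^ k + (m + 1)` in the numbering of the definition,
  -- so its predecessor `2 ^ k + m` still has logarithm `k`.
  have hlog : Nat.log 2 (2 ^ k + m + 1 - 1) = k := by
    rw [Nat.add_sub_cancel]
    exact (Nat.log_eq_iff (Or.inr ⟨by norm_num, by positivity⟩)).2
      ⟨by omega, by rw [pow_succ]; omega⟩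
  have : 0 < 2 ^ k := by positivity
  rw [faberSchauder, if_neg (by omega), if_neg (by omega), hlog]
  push_cast
  ring_nf

theorem faberSchauder_eq_zero {k m : ℕ} (hm : m < 2 ^ k) {x : ℝ}
    (hx : x ≤ franklinKnot k m (2 * m) ∨ franklinKnot k m (2 * m + 1) ≤ x) :
    faberSchauder (2 ^ k + m + 1) x = 0 := by
  rw [faberSchauder_of_lt hm]
  apply max_eq_left
  rcases hx with hx | hx
  · rw [franklinKnot_of_le le_rfl, le_div_iff₀ (by positivity)] at hx
    push_cast at hx
    have := neg_le_abs (2 ^ (k + 1) * x - (2 * m + 1))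
    linarith
  · rw [franklinKnot_of_ge (by omega), div_le_iff₀ (by positivity)] at hx
    push_cast at hx
    have := le_abs_self (2 ^ (k + 1) * x - (2 * m + 1))
    linarith

theorem faberSchauder_peak {k m : ℕ} (hm : m < 2 ^ k) :
    faberSchauder (2 ^ k + m + 1) (franklinKnot k (m + 1) (2 * m + 1)) = 1 := by
  rw [faberSchauder_of_lt hm, franklinKnot_succ_mid, mul_div_cancel₀ _ (by positivity)]
  simp

theorem affineOnIcc_faberSchauder_self {k m : ℕ} (hm : m < 2 ^ k) (i : ℕ) :
    AffineOnIcc (faberSchauder (2 ^ k + m + 1)) (franklinKnot k (m + 1) i)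
      (franklinKnot k (m + 1) (i + 1)) := by
  have hmono := (strictMono_franklinKnot k (m + 1)).monotone
  rcases lt_trichotomy i (2 * m) with h | rfl | h
  · refine ⟨0, 0, fun s hs => ?_⟩
    rw [faberSchauder_eq_zero hm, zero_mul, zero_add]
    left
    rw [← franklinKnot_succ_of_le le_rfl]
    exact hs.2.trans (hmono h)
  · refine ⟨2 ^ (k + 1), -(2 * m), fun s hs => ?_⟩
    obtain ⟨h1, h2⟩ := hs
    rw [franklinKnot_of_le (by omega), div_le_iff₀ (by positivity)] at h1
    rw [franklinKnot_succ_mid, le_div_iff₀ (by positivity)] at h2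
    push_cast at h1
    rw [faberSchauder_of_lt hm, abs_of_nonpos (by linarith), max_eq_right (by linarith)]
    ring
  · rcases eq_or_lt_of_le (show 2 * m + 1 ≤ i from h) with rfl | h
    · refine ⟨-2 ^ (k + 1), 2 * m + 2, fun s hs => ?_⟩
      obtain ⟨h1, h2⟩ := hs
      rw [franklinKnot_succ_mid, div_le_iff₀ (by positivity)] at h1
      rw [franklinKnot_of_ge (by omega), le_div_iff₀ (by positivity)] at h2
      push_cast at h2
      rw [faberSchauder_of_lt hm, abs_of_nonneg (by linarith), max_eq_right (by linarith)]
      ring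
    · refine ⟨0, 0, fun s hs => ?_⟩
      rw [faberSchauder_eq_zero hm, zero_mul, zero_add]
      right
      rw [← franklinKnot_succ_of_ge le_rfl]
      exact (hmono (by omega)).trans hs.1

/-- Raising `m` by one only inserts the midpoint of the old gap number `2 * m`, so every new gap
sits inside an old one. -/
theorem franklinKnot_refine {k m i : ℕ} (hi : i < 2 ^ k + (m + 1)) (hm : m < 2 ^ k) :
    ∃ j < 2 ^ k + m, Set.Icc (franklinKnot k (m + 1) i) (franklinKnot k (m + 1) (i + 1)) ⊆
      Set.Icc (franklinKnot k m j) (franklinKnot k m (j + 1)) := by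
  have hmono := (strictMono_franklinKnot k (m + 1)).monotone
  rcases Nat.lt_or_ge i (2 * m) with h | h
  · refine ⟨i, by omega, ?_⟩
    rw [franklinKnot_succ_of_le h.le, franklinKnot_succ_of_le h]
  rcases Nat.lt_or_ge i (2 * m + 2) with h' | h'
  · refine ⟨2 * m, by omega, ?_⟩
    rw [← franklinKnot_succ_of_le le_rfl, ← franklinKnot_succ_of_ge le_rfl]
    exact Set.Icc_subset_Icc (hmono h) (hmono (by omega))
  · obtain ⟨j, rfl⟩ : ∃ j, i = j + 1 := ⟨i - 1, by omega⟩
    refine ⟨j, by omega, ?_⟩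
    rw [franklinKnot_succ_of_ge (by omega), franklinKnot_succ_of_ge (by omega)]

/-- Induction over the pairs `(k, m)` with `m ≤ 2 ^ k`, where `(k, 2 ^ k)` and `(k + 1, 0)` describe
the same space. -/
theorem franklin_level_induction {P : ℕ → ℕ → Prop} (h0 : P 0 0)
    (hm : ∀ k m, m < 2 ^ k → P k m → P k (m + 1)) (hk : ∀ k, P k (2 ^ k) → P (k + 1) 0)
    {k m : ℕ} (h : m ≤ 2 ^ k) : P k m := by
  have step : ∀ k, P k 0 → ∀ m ≤ 2 ^ k, P k m := by
    intro k hk0 m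
    induction m with
    | zero => exact fun _ => hk0
    | succ m ih => exact fun h => hm k m h (ih (by omega))
  have base : ∀ k, P k 0 := by
    intro k
    induction k with
    | zero => exact h0
    | succ k ih => exact hk k (step k ih _ le_rfl)
  exact step k (base k) m h

theorem affineOnIcc_faberSchauder {k m : ℕ} (hm : m ≤ 2 ^ k) :
    ∀ j ≤ 2 ^ k + m, ∀ i < 2 ^ k + m,
      AffineOnIcc (faberSchauder j) (franklinKnot k m i) (franklinKnot k m (i + 1)) := by
  refine franklin_level_induction (P := fun k m => ∀ j ≤ 2 ^ k + m, ∀ i < 2 ^ k + m,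
      AffineOnIcc (faberSchauder j) (franklinKnot k m i) (franklinKnot k m (i + 1))) ?_ ?_ ?_ hm
  · intro j hj i _
    rcases Nat.eq_zero_or_pos j with rfl | hpos
    · exact ⟨0, 1, fun s _ => by simp [faberSchauder]⟩
    · obtain rfl : j = 1 := by simp at hj; omega
      exact ⟨1, 0, fun s _ => by simp [faberSchauder]⟩
  · intro k m hm ih j hj i hi
    rcases Nat.lt_or_ge (2 ^ k + m) j with h | h
    · obtain rfl : j = 2 ^ k + m + 1 := by omega
      exact affineOnIcc_faberSchauder_self hm i
    · obtain ⟨l, hl, hsub⟩ := franklinKnot_refine hi hm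
      exact (ih j h l hl).mono hsub
  · intro k ih j hj i hi
    have e : 2 ^ (k + 1) + 0 = 2 ^ k + 2 ^ k := by ring
    rw [e] at hj hi
    rw [franklinKnot_next_level hi.le, franklinKnot_next_level hi]
    exact ih j hj i hi

/-- Each new tent function vanishes at the old knots and equals `1` at the inserted one, so it
corrects the value there without disturbing the others. This places the hat functions in the span.
-/
theorem exists_interpolation {k m : ℕ} (hm : m ≤ 2 ^ k) :
    ∀ v : ℕ → ℝ, ∃ u ∈ Submodule.span ℝ (faberSchauder '' Set.Iic (2 ^ k + m)),
      ∀ i ≤ 2 ^ k + m, u (franklinKnot k m i) = v i := by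
  refine franklin_level_induction (P := fun k m => ∀ v : ℕ → ℝ,
    ∃ u ∈ Submodule.span ℝ (faberSchauder '' Set.Iic (2 ^ k + m)),
      ∀ i ≤ 2 ^ k + m, u (franklinKnot k m i) = v i) ?_ ?_ ?_ hm
  · intro v
    refine ⟨v 0 • faberSchauder 0 + (v 1 - v 0) • faberSchauder 1,
      Submodule.add_mem _ (Submodule.smul_mem _ _ (Submodule.subset_span ⟨0, by simp, rfl⟩))
        (Submodule.smul_mem _ _ (Submodule.subset_span ⟨1, by simp, rfl⟩)), fun i hi => ?_⟩
    have h1 : franklinKnot 0 0 1 = 1 := franklinKnot_last (by simp)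
    have : i = 0 ∨ i = 1 := by simp at hi; omega
    rcases this with rfl | rfl <;> simp [franklinKnot_zero, h1, faberSchauder]
  · intro k m hm ih v
    obtain ⟨u, hu, huv⟩ := ih fun i => if i ≤ 2 * m then v i else v (i + 1)
    refine ⟨u + (v (2 * m + 1) - u (franklinKnot k (m + 1) (2 * m + 1))) •
        faberSchauder (2 ^ k + m + 1),
      Submodule.add_mem _ (Submodule.span_mono (Set.image_mono (Set.Iic_subset_Iic.2 (by omega)))
        hu) (Submodule.smul_mem _ _ (Submodule.subset_span
          ⟨_, Set.mem_Iic.2 (by omega), rfl⟩)), fun i hi => ?_⟩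
    have hmono := (strictMono_franklinKnot k m).monotone
    simp only [Pi.add_apply, Pi.smul_apply, smul_eq_mul]
    rcases lt_trichotomy i (2 * m + 1) with h | rfl | h
    · rw [franklinKnot_succ_of_le (by omega),
        faberSchauder_eq_zero hm (Or.inl (hmono (by omega))), huv i (by omega),
        if_pos (by omega)]
      ring
    · rw [faberSchauder_peak hm]
      ring
    · obtain ⟨j, rfl⟩ : ∃ j, i = j + 1 := ⟨i - 1, by omega⟩
      rw [franklinKnot_succ_of_ge (by omega),
        faberSchauder_eq_zero hm (Or.inr (hmono (by omega))), huv j (by omega),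
        if_neg (by omega)]
      ring
  · intro k ih v
    obtain ⟨u, hu, huv⟩ := ih v
    have e : 2 ^ (k + 1) + 0 = 2 ^ k + 2 ^ k := by ring
    rw [e]
    refine ⟨u, hu, fun i hi => ?_⟩
    rw [franklinKnot_next_level hi]
    exact huv i hi

theorem affineOnIcc_of_mem_span {k m : ℕ} (hm : m ≤ 2 ^ k) {u : ℝ → ℝ}
    (hu : u ∈ Submodule.span ℝ (faberSchauder '' Set.Iic (2 ^ k + m))) {i : ℕ}
    (hi : i < 2 ^ k + m) :
    AffineOnIcc u (franklinKnot k m i) (franklinKnot k m (i + 1)) := by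
  induction hu using Submodule.span_induction with
  | mem x h => obtain ⟨j, hj, rfl⟩ := h; exact affineOnIcc_faberSchauder hm j hj i hi
  | zero => exact ⟨0, 0, fun s _ => by simp⟩
  | add x y _ _ hx hy => exact hx.add hy
  | smul a x _ hx => exact hx.smul a

theorem affineOnIcc_franklin {k m : ℕ} (hm : m ≤ 2 ^ k) {j i : ℕ} (hj : j ≤ 2 ^ k + m)
    (hi : i < 2 ^ k + m) :
    AffineOnIcc (franklin j) (franklinKnot k m i) (franklinKnot k m (i + 1)) :=
  affineOnIcc_of_mem_span hm (Submodule.span_mono (Set.image_mono (Set.Iic_subset_Iic.2 hj))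
    (franklin_mem_span j)) hi

/-! ### The localized estimate of the partial sums -/

/-- The point `t` is the knot where the weighted knot value of the partial sum is largest; it
depends on `y` and `f`. The constant is `36 = 24 · 3 / 2`, the last factor paying for the weight at
the knots next to `y`. -/
theorem norm_franklinSum_le {𝕜 : Type*} [RCLike 𝕜]
    {f : ℝ → 𝕜} (hf : IntervalIntegrable f volume 0 1) {k m : ℕ}
    (hm : m ≤ 2 ^ k) {y : ℝ} (hy : y ∈ Set.Icc (0 : ℝ) 1) :
    ∃ t ∈ Set.Icc (0 : ℝ) 1, ‖franklinSum f (2 ^ k + m) y‖ ≤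
      36 * 2 ^ k * Real.exp (-(2 ^ k * |t - y| / 3)) *
        ∫ s in Set.Icc (0 : ℝ) 1 ∩ Set.Icc (t - 1 / 2 ^ k) (t + 1 / 2 ^ k), ‖f s‖ := by
  have hmono := strictMono_franklinKnot k m
  have hlast := franklinKnot_last hm
  have hfirst := franklinKnot_zero k m
  set N := 2 ^ k + m with hNdef
  have hN : N ≠ 0 := by positivity
  set τ := franklinKnot k m with hτ
  have hlen : ∀ i, τ (i + 1) - τ i ≤ 1 / 2 ^ k := fun i => (franklinKnot_succ_sub k m i).2
  choose w hw hwv using fun j : ℕ => exists_interpolation hm fun i => if i = j then 1 else 0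
  have hwaff : ∀ j, ∀ i < N, AffineOnIcc (w j) (τ i) (τ (i + 1)) :=
    fun j i hi => affineOnIcc_of_mem_span hm (hw j) hi
  have hwc : ∀ j, Continuous (w j) := fun j => continuous_of_mem_span_faberSchauder (hw j)
  have hfaff : ∀ j ∈ Finset.range (N + 1), ∀ i < N, AffineOnIcc (franklin j) (τ i) (τ (i + 1)) :=
    fun j hj i hi => affineOnIcc_franklin hm (Nat.lt_succ_iff.1 (Finset.mem_range.1 hj)) hi
  obtain ⟨j, hj, hmax⟩ := exists_weighted_bound (h := 1 / 2 ^ k) (by positivity)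
    (fun i => (franklinKnot_succ_sub k m i).1) hlen hN (fun i => franklinSum f N (τ i))
    (fun j => ∫ s in (0 : ℝ)..1, w j s • f s) (fun j hj => by
      -- Testing against the hat `w j` replaces `f` by its projection; the resulting inner products
      -- involve only the knots `j - 1`, `j`, `j + 1`, which is row `j` of the system.
      rw [← franklinReproduces_of_mem_span hf (hw j)]
      have key : ∀ i ∈ Finset.range (N + 1), ∫ s in (0 : ℝ)..1, franklin i s * w j s =
          (if j < N then (τ (j + 1) - τ j) / 6 * (2 * franklin i (τ j) + franklin i (τ (j + 1)))
            else 0) +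
          (if 0 < j then (τ j - τ (j - 1)) / 6 * (franklin i (τ (j - 1)) + 2 * franklin i (τ j))
            else 0) :=
        fun i hi => by
          have := integral_mul_hat hmono.monotone hj (continuous_franklin i) (hwc j)
            (hfaff i hi) (hwaff j) (hwv j)
          rwa [hfirst, hlast] at this
      rw [Finset.sum_congr rfl fun i hi => by rw [key i hi]]
      simp only [add_smul, Finset.sum_add_distrib]
      congr 1
      · split_ifs
        · simp only [franklinSum, Finset.smul_sum, ← Finset.sum_add_distrib]
          refine Finset.sum_congr rfl fun i _ => ?_
          module
        · simp
      · split_ifs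
        · simp only [franklinSum, Finset.smul_sum, ← Finset.sum_add_distrib]
          refine Finset.sum_congr rfl fun i _ => ?_
          module
        · simp) y
  have hexp : ∀ i, |τ i - y| / (3 * (1 / 2 ^ k)) = 2 ^ k * |τ i - y| / 3 := by
    intro i
    field_simp
  have hmax : ∀ l ≤ N, Real.exp (-(2 ^ k * |τ l - y| / 3)) * ‖franklinSum f N (τ l)‖ ≤
      24 / (1 / 2 ^ k) * Real.exp (-(2 ^ k * |τ j - y| / 3)) *
        ‖∫ s in (0 : ℝ)..1, w j s • f s‖ := by
    intro l hl
    rw [← hexp l, ← hexp j]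
    exact hmax l hl
  have hτj : τ j ∈ Set.Icc (0 : ℝ) 1 :=
    ⟨hfirst ▸ hmono.monotone (Nat.zero_le j), hlast ▸ hmono.monotone hj⟩
  refine ⟨τ j, hτj, ?_⟩
  set I := ∫ s in Set.Icc (0 : ℝ) 1 ∩ Set.Icc (τ j - 1 / 2 ^ k) (τ j + 1 / 2 ^ k), ‖f s‖ with hI
  have hb : ‖∫ s in (0 : ℝ)..1, w j s • f s‖ ≤ I := by
    have hfi : IntegrableOn f (Set.Icc 0 1) := by
      rwa [intervalIntegrable_iff_integrableOn_Icc_of_le zero_le_one] at hf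
    rw [intervalIntegral.integral_of_le zero_le_one, ← integral_Icc_eq_integral_Ioc, hI,
      ← setIntegral_indicator measurableSet_Icc]
    refine norm_integral_le_of_norm_le (hfi.norm.indicator measurableSet_Icc) ?_
    filter_upwards [ae_restrict_mem measurableSet_Icc] with s hs
    have := abs_hat_le hmono hlen hN (hwaff j) (hwv j) (s := s) (by rwa [hfirst, hlast])
    rw [norm_smul, Real.norm_eq_abs]
    refine (mul_le_mul_of_nonneg_right this (norm_nonneg _)).trans ?_
    by_cases hmem : s ∈ Set.Icc (τ j - 1 / 2 ^ k) (τ j + 1 / 2 ^ k)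
    · rw [Set.indicator_of_mem hmem, Set.indicator_of_mem hmem, Pi.one_apply, one_mul]
    · rw [Set.indicator_of_notMem hmem, Set.indicator_of_notMem hmem, zero_mul]
  obtain ⟨i, hi, hyi⟩ := exists_mem_Icc_succ τ hN (hfirst ▸ hy.1) (hlast ▸ hy.2)
  have hlt : τ i < τ (i + 1) := hmono (Nat.lt_succ_self i)
  have hpos := sub_pos.2 hlt
  have near : ∀ l ≤ N, |τ l - y| ≤ 1 / 2 ^ k → ‖franklinSum f N (τ l)‖ ≤
      36 * 2 ^ k * Real.exp (-(2 ^ k * |τ j - y| / 3)) * I := by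
    intro l hl hd
    have h1 := hmax l hl
    have h2 : 1 ≤ 3 / 2 * Real.exp (-(2 ^ k * |τ l - y| / 3)) := by
      refine le_trans ?_ (mul_le_mul_of_nonneg_right exp_one_third_le (Real.exp_pos _).le)
      rw [← Real.exp_add, Real.one_le_exp_iff]
      rw [le_div_iff₀ (by positivity)] at hd
      linarith
    calc ‖franklinSum f N (τ l)‖
        ≤ 3 / 2 * Real.exp (-(2 ^ k * |τ l - y| / 3)) * ‖franklinSum f N (τ l)‖ :=
          le_mul_of_one_le_left (norm_nonneg _) h2
      _ ≤ 3 / 2 * (24 / (1 / 2 ^ k) * Real.exp (-(2 ^ k * |τ j - y| / 3)) *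
            ‖∫ s in (0 : ℝ)..1, w j s • f s‖) := by
          rw [mul_assoc]
          exact mul_le_mul_of_nonneg_left h1 (by norm_num)
      _ ≤ 3 / 2 * (24 / (1 / 2 ^ k) * Real.exp (-(2 ^ k * |τ j - y| / 3)) * I) := by gcongr
      _ = _ := by
          rw [div_div_eq_mul_div, div_one]
          ring
  -- The partial sum at `y` is a convex combination of its values at the two knots enclosing `y`, so
  -- the bound there carries over.
  have hconv : franklinSum f N y = ((τ (i + 1) - y) / (τ (i + 1) - τ i)) • franklinSum f N (τ i) +
      ((y - τ i) / (τ (i + 1) - τ i)) • franklinSum f N (τ (i + 1)) := by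
    simp only [franklinSum, Finset.smul_sum, ← Finset.sum_add_distrib]
    refine Finset.sum_congr rfl fun l hl => ?_
    rw [(hfaff l hl i hi).eq_interpolation hlt hyi]
    module
  have e1 : 0 ≤ (τ (i + 1) - y) / (τ (i + 1) - τ i) :=
    div_nonneg (sub_nonneg.2 hyi.2) hpos.le
  have e2 : 0 ≤ (y - τ i) / (τ (i + 1) - τ i) := div_nonneg (sub_nonneg.2 hyi.1) hpos.le
  have e3 : (τ (i + 1) - y) / (τ (i + 1) - τ i) + (y - τ i) / (τ (i + 1) - τ i) = 1 := by
    field_simp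
    ring
  have n1 := near i hi.le (by
    rw [abs_sub_comm, abs_of_nonneg (sub_nonneg.2 hyi.1)]; linarith [hlen i, hyi.2])
  have n2 := near (i + 1) hi (by
    rw [abs_of_nonneg (sub_nonneg.2 hyi.2)]; linarith [hlen i, hyi.1])
  rw [hconv]
  refine (norm_add_le _ _).trans ?_
  rw [norm_smul, norm_smul, Real.norm_of_nonneg e1, Real.norm_of_nonneg e2]
  refine (add_le_add (mul_le_mul_of_nonneg_left n1 e1)
    (mul_le_mul_of_nonneg_left n2 e2)).trans_eq ?_
  rw [← add_mul, e3, one_mul]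

/-! ### Convergence at Lebesgue points -/

/-- The function `J` stands for the integral of the deviation from `a` over a window of radius `h`
about the Lebesgue point. Hypothesis `hb` isolates the only geometric input, so the interval and the
circle share one argument. -/
theorem tendsto_franklinSum_of_local_bound {𝕜 : Type*} [RCLike 𝕜]
    {f : ℝ → 𝕜} (hf : IntervalIntegrable f volume 0 1)
    (a : 𝕜) {y : ℕ → ℝ} (hy : ∀ᶠ n in atTop, y n ∈ Set.Icc (0 : ℝ) 1) {J : ℝ → ℝ}
    (hJ : Tendsto (fun h : ℝ => 1 / (2 * h) * J h) (𝓝[>] 0) (𝓝 0)) {C : ℝ} (hC : 0 ≤ C)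
    (hb : ∀ᶠ n : ℕ in atTop, ∀ t ∈ Set.Icc (0 : ℝ) 1, ∀ ρ h : ℝ, 0 < ρ →
      ρ + |t - y n| + C * (1 / n) ≤ h →
      ∫ s in Set.Icc (0 : ℝ) 1 ∩ Set.Icc (t - ρ) (t + ρ), ‖f s - a‖ ≤ J h) :
    Tendsto (fun n : ℕ => franklinSum f n (y n)) atTop (𝓝 a) := by
  have hfa : IntervalIntegrable (fun s => f s - a) volume 0 1 := hf.sub intervalIntegrable_const
  have hfa' : IntegrableOn (fun s => f s - a) (Set.Icc 0 1) := by
    rwa [intervalIntegrable_iff_integrableOn_Icc_of_le zero_le_one] at hfa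
  rw [tendsto_iff_norm_sub_tendsto_zero, Metric.tendsto_atTop']
  suffices H : ∀ ε > 0, ∀ᶠ n : ℕ in atTop, ‖franklinSum f n (y n) - a‖ < ε by
    intro ε hε
    obtain ⟨n0, h0⟩ := eventually_atTop.1 (H ε hε)
    exact ⟨n0, fun n hn => by
      rw [Real.dist_eq, sub_zero, abs_of_nonneg (norm_nonneg _)]
      exact h0 n (le_of_lt hn)⟩
  intro ε hε
  set D := 1 + C with hD
  have hDpos : 0 < D := by linarith
  set A := ∫ s in Set.Icc (0 : ℝ) 1, ‖f s - a‖ with hA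
  have hA0 : 0 ≤ A := integral_nonneg fun _ => norm_nonneg _
  -- Chosen so that the near case below totals `72 * η * (D + 3) = ε / 2`.
  set η := ε / (144 * (D + 3)) with hη
  have hη0 : 0 < η := by positivity
  obtain ⟨δ, hδ, hJδ⟩ : ∃ δ > 0, ∀ h, 0 < h → h < δ → J h ≤ 2 * h * η := by
    obtain ⟨δ, hδ, h1⟩ := (mem_nhdsGT_iff_exists_Ioo_subset).1
      (hJ.eventually (gt_mem_nhds hη0))
    refine ⟨δ, hδ, fun h h2 h3 => ?_⟩
    have h4 : 1 / (2 * h) * J h < η := h1 ⟨h2, h3⟩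
    rw [one_div_mul_eq_div, div_lt_iff₀ (by positivity)] at h4
    linarith
  -- In the far case `r ≥ δ q - D` with `q = 2 ^ k ≥ n / 2`, so `exp (-r / 3)` is at most `exp (D /
  -- 3) * exp (-δ n / 6)`.
  have hlim : Tendsto (fun n : ℕ => 36 * Real.exp (D / 3) * A *
      ((n : ℝ) ^ 1 * Real.exp (-(δ / 6) * n))) atTop (𝓝 0) := by
    have h1 := (Real.tendsto_pow_mul_exp_neg_atTop_nhds_zero 1).comp
      ((tendsto_natCast_atTop_atTop (R := ℝ)).const_mul_atTop (show 0 < δ / 6 by positivity))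
    have h2 := h1.const_mul (36 * Real.exp (D / 3) * A * (6 / δ))
    rw [mul_zero] at h2
    refine h2.congr fun n => ?_
    simp only [Function.comp_apply, pow_one, neg_mul]
    field_simp
  filter_upwards [hy, hb, hlim.eventually (gt_mem_nhds hε), eventually_ge_atTop 2]
    with n hyn hbn hn hn2
  obtain ⟨k, m, hm, rfl⟩ : ∃ k m, m ≤ 2 ^ k ∧ n = 2 ^ k + m := by
    have h1 := Nat.pow_log_le_self 2 (show n - 1 ≠ 0 by omega)
    have h2 := Nat.lt_pow_succ_log_self (b := 2) (by norm_num) (n - 1)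
    rw [pow_succ] at h2
    exact ⟨Nat.log 2 (n - 1), n - 2 ^ Nat.log 2 (n - 1), by omega, by omega⟩
  obtain ⟨t, ht, hbd⟩ := norm_franklinSum_le hfa hm hyn
  rw [franklinSum_sub_const hf] at hbd
  refine hbd.trans_lt ?_
  set n := 2 ^ k + m with hndef
  have hq1 : (2 : ℝ) ^ k ≤ n := by
    rw [hndef]
    push_cast
    linarith [(Nat.cast_nonneg m : (0 : ℝ) ≤ m)]
  have hq2 : (n : ℝ) ≤ 2 * 2 ^ k := by
    have : (m : ℝ) ≤ 2 ^ k := by exact_mod_cast hm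
    rw [hndef]; push_cast; linarith
  have hq : (0 : ℝ) < 2 ^ k := by positivity
  generalize (2 : ℝ) ^ k = q at *
  have hr : 0 ≤ q * |t - y n| := by positivity
  set r := q * |t - y n| with hrdef
  set I := ∫ s in Set.Icc (0 : ℝ) 1 ∩ Set.Icc (t - 1 / q) (t + 1 / q), ‖f s - a‖ with hI
  -- The radius `(D + r) / q` covers the mesh size `1 / q`, the distance `r / q` from `t` to `y n`,
  -- and the shift, at most `C / q`.
  rcases lt_or_ge ((D + r) / q) δ with hlt | hge
  · have h1 : I ≤ 2 * ((D + r) / q) * η := by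
      refine (hbn t ht (1 / q) ((D + r) / q) (by positivity) ?_).trans
        (hJδ _ (by positivity) hlt)
      have h2 : C * (1 / n) ≤ C * (1 / q) := by gcongr
      have h3 : (D + r) / q = 1 / q + |t - y n| + C * (1 / q) := by
        rw [hrdef, hD]
        field_simp
        ring
      linarith
    have h2 : Real.exp (-(r / 3)) ≤ 1 := Real.exp_le_one_iff.2 (by linarith)
    have h3 : r * Real.exp (-(r / 3)) ≤ 3 := by
      have h4 := Real.add_one_le_exp (r / 3)
      rw [Real.exp_neg, ← div_eq_mul_inv, div_le_iff₀ (Real.exp_pos _)]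
      linarith
    calc 36 * q * Real.exp (-(r / 3)) * I
        ≤ 36 * q * Real.exp (-(r / 3)) * (2 * ((D + r) / q) * η) := by gcongr
      _ = 72 * η * (D * Real.exp (-(r / 3)) + r * Real.exp (-(r / 3))) := by
          field_simp
          ring
      _ ≤ 72 * η * (D * 1 + 3) := by gcongr
      _ = ε / 2 := by
          rw [hη]
          field_simp
          norm_num
      _ < ε := by linarith
  · have h1 : I ≤ A :=
      setIntegral_mono_set hfa'.norm (ae_of_all _ fun _ => norm_nonneg _)
        Set.inter_subset_left.eventuallyLE
    rw [le_div_iff₀ hq] at hge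
    have h2 : Real.exp (-(r / 3)) ≤ Real.exp (D / 3) * Real.exp (-(δ / 6) * n) := by
      rw [← Real.exp_add, Real.exp_le_exp]
      nlinarith
    refine lt_of_le_of_lt ?_ hn
    calc 36 * q * Real.exp (-(r / 3)) * I
        ≤ 36 * n * (Real.exp (D / 3) * Real.exp (-(δ / 6) * n)) * A := by gcongr
      _ = _ := by ring

/-! ### Periodic extension and conclusion -/

theorem integrableOn_Icc_comp_fract {𝕜 : Type*} [RCLike 𝕜]
    {f : ℝ → 𝕜} (hf : IntervalIntegrable f volume 0 1) (a b : ℝ) :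
    IntegrableOn (fun t => f (Int.fract t)) (Set.Icc a b) := by
  rcases lt_or_ge b a with h | h
  · rw [Set.Icc_eq_empty (not_le.2 h)]
    exact integrableOn_empty
  have hper : Function.Periodic (fun t => f (Int.fract t)) 1 := fun t => by
    simp only [Int.fract_add_one]
  rw [← intervalIntegrable_iff_integrableOn_Icc_of_le h]
  refine hper.intervalIntegrable₀ one_ne_zero ?_ a b
  refine hf.congr_ae ?_
  rw [Set.uIoc_of_le zero_le_one, ← Measure.restrict_congr_set Ioo_ae_eq_Ioc]
  filter_upwards [ae_restrict_mem measurableSet_Ioo] with s hs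
  rw [Int.fract_eq_self.2 ⟨hs.1.le, hs.2⟩]

theorem mainTheorem7 {𝕜 : Type*} [RCLike 𝕜] (f : ℝ → 𝕜)
    (hf : IntegrableOn f (Set.Ioo (0 : ℝ) 1) volume)
    (θ : ℕ → ℝ) (hθ : θ =O[atTop] (fun n : ℕ => 1 / (n : ℝ))) :
    -- points of the interval
    (∀ x ∈ Set.Icc (0 : ℝ) 1, IsLebesguePointOn (Set.Icc 0 1) f x →
      (∀ᶠ n in atTop, x + θ n ∈ Set.Icc (0 : ℝ) 1) →
      Tendsto (fun n : ℕ => franklinSum f n (x + θ n)) atTop (𝓝 (f x))) ∧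
    -- points of the circle `ℝ / ℤ`, everything extended from `[0, 1)` with period `1`
    (∀ x : ℝ, IsLebesguePointOn Set.univ (fun t => f (Int.fract t)) x →
      Tendsto (fun n : ℕ => franklinSum f n (Int.fract (x + θ n))) atTop
        (𝓝 (f (Int.fract x)))) := by
  have hfi : IntervalIntegrable f volume 0 1 :=
    (intervalIntegrable_iff_integrableOn_Ioo_of_le zero_le_one).2 hf
  obtain ⟨C, hC, hθC⟩ := hθ.exists_pos
  have hθ' : ∀ᶠ n : ℕ in atTop, |θ n| ≤ C * (1 / n) := by
    filter_upwards [hθC.bound] with n hn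
    rwa [Real.norm_eq_abs, Real.norm_of_nonneg (by positivity)] at hn
  have dist_bound : ∀ {x u v w ρ b h : ℝ}, u ∈ Set.Icc (v - ρ) (v + ρ) → |w| ≤ b →
      ρ + |v - (x + w)| + b ≤ h → u ∈ Set.Icc (x - h) (x + h) := by
    intro x u v w ρ b h hu hw hh
    obtain ⟨h1, h2⟩ := hu
    have h3 := abs_le.1 (le_refl |v - (x + w)|)
    have h4 := abs_le.1 hw
    exact ⟨by linarith, by linarith⟩
  refine ⟨fun x _ hL hmem => ?_, fun x hL => ?_⟩
  · have hint : IntegrableOn (fun s => ‖f s - f x‖) (Set.Icc 0 1) :=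
      ((intervalIntegrable_iff_integrableOn_Icc_of_le zero_le_one).1
        (hfi.sub intervalIntegrable_const)).norm
    refine tendsto_franklinSum_of_local_bound hfi (f x) hmem hL hC.le ?_
    filter_upwards [hθ'] with n hn t _ ρ h _ hh
    refine setIntegral_mono_set (hint.mono_set Set.inter_subset_left)
      (ae_of_all _ fun _ => norm_nonneg _) (LE.le.eventuallyLE ?_)
    exact Set.inter_subset_inter_right _ fun s hs => dist_bound hs hn hh
  · set a := f (Int.fract x) with ha
    set G : ℝ → ℝ := fun s => ‖f (Int.fract s) - a‖ with hG
    refine tendsto_franklinSum_of_local_bound hfi a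
      (Eventually.of_forall fun n => ⟨Int.fract_nonneg _, (Int.fract_lt_one _).le⟩) hL hC.le ?_
    filter_upwards [hθ'] with n hn t _ ρ h _ hh
    have hint : IntegrableOn G (Set.univ ∩ Set.Icc (x - h) (x + h)) := by
      rw [Set.univ_inter]
      exact ((integrableOn_Icc_comp_fract hfi _ _).sub
        (continuousOn_const.integrableOn_compact isCompact_Icc)).norm
    -- Translation by `z` carries the fractional part of `x + θ n` back to `x + θ n`, hence the
    -- window about `t` into `[x - h, x + h]`. Cutting that window off at `0` and `1` only lowers
    -- the integral, so no wrap-around across the seam arises.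
    set z : ℝ := (⌊x + θ n⌋ : ℝ) with hz
    have hmp := measurePreserving_add_right (volume : Measure ℝ) z
    have hme := measurableEmbedding_addRight z
    -- At `s = 1` the periodic extension takes the value `f 0` rather than `f 1`.
    have hne : ∀ᵐ s : ℝ, s ≠ 1 := by simp [ae_iff]
    calc ∫ s in Set.Icc (0 : ℝ) 1 ∩ Set.Icc (t - ρ) (t + ρ), ‖f s - a‖
        = ∫ s in Set.Icc (0 : ℝ) 1 ∩ Set.Icc (t - ρ) (t + ρ), G (s + z) := by
          refine setIntegral_congr_ae (measurableSet_Icc.inter measurableSet_Icc) ?_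
          filter_upwards [hne] with s hs hs'
          have : Int.fract s = s := Int.fract_eq_self.2 ⟨hs'.1.1, lt_of_le_of_ne hs'.1.2 hs⟩
          rw [hG, hz]
          simp only [Int.fract_add_intCast, this]
      _ ≤ ∫ s in (fun s => s + z) ⁻¹' (Set.univ ∩ Set.Icc (x - h) (x + h)), G (s + z) := by
          refine setIntegral_mono_set ((hmp.integrableOn_comp_preimage hme).2 hint)
            (ae_of_all _ fun _ => norm_nonneg _) (LE.le.eventuallyLE ?_)
          intro s hs
          refine ⟨Set.mem_univ _, dist_bound (v := t + z) (w := θ n) (ρ := ρ) ?_ hn ?_⟩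
          · exact ⟨by linarith [hs.2.1], by linarith [hs.2.2]⟩
          · refine le_trans (le_of_eq ?_) hh
            rw [← Int.self_sub_floor, ← hz]
            congr 3
            ring
      _ = _ := hmp.setIntegral_preimage_emb hme _ _
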